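/- Let $H$ be a complex Hilbert space. For a linear operator $T$ in $H$ with domain $D(T)$, null space $N(T)$ and range $R(T)$, put $D(T^2)=\{x\in D(T): Tx\in D(T)\}$. Call $T$ paranormal if $\|Tx\|^2\le\|T^2x\|\,\|x\|$ for all $x\in D(T^2)$, and call $T$ symmetric if it is densely defined and $T\subseteq T^*$. For a densely defined closed operator $T$ in $H$, let the spectrum $\sigma(T)$ be the set of all $\lambda\in\mathbb{C}$ for which $T-\lambda I$ is not a bijection of $D(T)$ onto $H$ with bounded inverse. Call $T$ Fredholm if $R(T)$ is closed and $N(T)$ and $R(T)^\perp$ are finite-dimensional; its index is then $\dim N(T)-\dim R(T)^\perp$. Let $$\omega(T)=\{\lambda\in\mathbb{C}: T-\lambda I\text{ is not a Fredholm operator of index }0\}$$ be the Weyl spectrum of $T$, and let $\pi_{00}(T)$ be the set of all eigenvalues $\lambda$ of $T$ that are isolated points of $\sigma(T)$ and satisfy $\dim N(T-\lambda I)<\infty$. (i) If $T$ is a densely defined closed paranormal operator in $H$, then $T$ satisfies Weyl's theorem, that is, $\sigma(T)\setminus\omega(T)=\pi_{00}(T)$. (ii) Every closed symmetric operator $T$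 in $H$ satisfies Weyl's theorem, that is, $\sigma(T)\setminus\omega(T)=\pi_{00}(T)$. -/

import Mathlib

namespace UnboundedOp

variable {H : Type*} [NormedAddCommGroup H] [InnerProductSpace ℂ H]

/-- The operator `T - z I`, with domain `D(T)`. -/
def shift (T : H →ₗ.[ℂ] H) (z : ℂ) : H →ₗ.[ℂ] H where
  domain := T.domain
  toFun := T.toFun - z • T.domain.subtype

theorem shift_apply (T : H →ₗ.[ℂ] H) (z : ℂ) (x : T.domain) :
    shift T z x = T x - z • (x : H) := rfl

/-- The null space `N(T)`, as a subspace of `H`. -/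
def nullSpace (T : H →ₗ.[ℂ] H) : Submodule ℂ H :=
  (LinearMap.ker T.toFun).map T.domain.subtype

/-- The range `R(T)`. -/
def rangeSpace (T : H →ₗ.[ℂ] H) : Submodule ℂ H :=
  LinearMap.range T.toFun

/-- `T` is paranormal: `‖T x‖² ≤ ‖T² x‖ ‖x‖` for all `x ∈ D(T²)`, where
`D(T²) = {x ∈ D(T) | T x ∈ D(T)}`. -/
def IsParanormal (T : H →ₗ.[ℂ] H) : Prop :=
  ∀ (x : T.domain) (hx : T x ∈ T.domain), ‖T x‖ ^ 2 ≤ ‖T ⟨T x, hx⟩‖ * ‖(x : H)‖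

/-- The densely defined operator `T` is symmetric: `T ⊆ T*`. -/
def IsSymm [CompleteSpace H] (T : H →ₗ.[ℂ] H) : Prop :=
  Dense (T.domain : Set H) ∧ T ≤ T.adjoint

/-- The resolvent set: those `z` for which `T - z I : D(T) → H` has an everywhere defined
bounded inverse `S`. -/
def resolvent (T : H →ₗ.[ℂ] H) : Set ℂ :=
  {z | ∃ S : H →L[ℂ] H,
    (∀ y : H, ∃ x : (shift T z).domain, (x : H) = S y ∧ shift T z x = y) ∧
    ∀ x : (shift T z).domain, S (shift T z x) = x}

/-- The spectrum `σ(T)`. -/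
def spec (T : H →ₗ.[ℂ] H) : Set ℂ := (resolvent T)ᶜ

/-- The point spectrum: those `z` for which `T - z I` is not injective. -/
def pointSpec (T : H →ₗ.[ℂ] H) : Set ℂ := {z | ¬ Function.Injective (shift T z)}

/-- A densely defined closed operator `T` is Fredholm if `R(T)` is closed and both `N(T)` and
`R(T)ᗮ` are finite-dimensional. -/
structure IsFredholm (T : H →ₗ.[ℂ] H) : Prop where
  dense_domain : Dense (T.domain : Set H)
  closed : T.IsClosed
  closed_range : IsClosed (rangeSpace T : Set H)
  finite_null : FiniteDimensional ℂ (nullSpace T)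
  finite_corange : FiniteDimensional ℂ (rangeSpace T)ᗮ

/-- The index `dim N(T) - dim R(T)ᗮ`; it is used for Fredholm operators only. -/
noncomputable def index (T : H →ₗ.[ℂ] H) : ℤ :=
  (Module.finrank ℂ (nullSpace T) : ℤ) - (Module.finrank ℂ (rangeSpace T)ᗮ : ℤ)

/-- The Weyl spectrum `ω(T)`. -/
def weylSpec (T : H →ₗ.[ℂ] H) : Set ℂ :=
  {z | ¬ (IsFredholm (shift T z) ∧ index (shift T z) = 0)}

/-- `z` is an isolated point of the set `A`. -/
def IsIsolatedPt (A : Set ℂ) (z : ℂ) : Prop :=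
  ∃ r : ℝ, 0 < r ∧ Metric.closedBall z r ∩ A = {z}

/-- `π₀₀(T)`: the eigenvalues of finite multiplicity that are isolated points of `σ(T)`. -/
def piZeroZero (T : H →ₗ.[ℂ] H) : Set ℂ :=
  {z | z ∈ pointSpec T ∧ IsIsolatedPt (spec T) z ∧
    FiniteDimensional ℂ (nullSpace (shift T z))}

/-- `T` satisfies Weyl's theorem. -/
def SatisfiesWeyl (T : H →ₗ.[ℂ] H) : Prop :=
  spec T \ weylSpec T = piZeroZero T

end UnboundedOp

/-!
A symmetric operator is paranormal, since `‖T x‖² = ⟪x, T² x⟫`, so only paranormal operators need an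
argument. Operators are handled through their graphs. The tool used throughout is that
`‖Tⁿ x‖` is log-convex in `n`: if it grows at most like `ρⁿ`, then `‖T x‖ ≤ ρ ‖x‖`
(`le_mul_of_logConvex`).

*Fredholm points of index zero belong to `π₀₀(T)`.* If `T - z I` is Fredholm of index zero, then
`T - z I + F` is boundedly invertible for some operator `F` of finite rank that vanishes on
`N(T - z I)ᗮ` (`IsFredholm.exists_finiteRank`). This persists near `z`, so `w` close to `z` is in the
resolvent set unless it is an eigenvalue (`mem_resolvent_of_finiteRank`). On the span of two
eigenvectors, `T` is bounded by its larger eigenvalue, and this forces eigenvectors for distinct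
eigenvalues to be orthogonal (`IsParanormal.inner_eq_zero`). An eigenvector for `w ≠ z` is therefore
orthogonal to `N(T - z I)`, where `T - z I` is bounded below, so `w` cannot be close to `z`.

*Points of `π₀₀(T)` are Fredholm of index zero.* Let `c` be isolated in the spectrum. The vectors
`∮ f(z) (T - z I)⁻¹ x dz` over small circles about `c`, with `f` holomorphic, make up the spectral
subspace of `c`, and there `T` acts by multiplying `f` by `z`. The radius of the circle is arbitrary,
so `Tⁿ` grows at most like `(|c| + t)ⁿ`, the backward iterates like `(|c| - t)⁻ⁿ` if `c ≠ 0`,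
and `(T - c I)ⁿ` like `tⁿ`, for all `t > 0`. By log-convexity `T` is `|c|` times an isometry on these
vectors (`IsParanormal.norm_integral_mul_eq`). This makes `T - c I` paranormal on them
(`norm_sub_smul_sq_le`), and log-convexity once more gives `T = c I` there
(`IsParanormal.integral_sub_eq_zero`). Hence the Riesz projection of `c` has range `N(T - c I)` and
kernel `R(T - c I)`, and `H = N(T - c I) ⊕ R(T - c I)` (`IsResolventOn.isFredholm_shift`).
-/

namespace UnboundedOp

open Metric

section

variable {H : Type*} [NormedAddCommGroup H] [InnerProductSpace ℂ H]

/-! ### Operators through their graphs -/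

theorem mem_graph_shift {T : H →ₗ.[ℂ] H} {z : ℂ} {u v : H} :
    (u, v) ∈ (shift T z).graph ↔ (u, v + z • u) ∈ T.graph := by
  simp only [LinearPMap.mem_graph_iff]
  constructor
  · rintro ⟨x, rfl, rfl⟩
    exact ⟨x, rfl, (sub_add_cancel (T x) (z • (x : H))).symm⟩
  · rintro ⟨x, rfl, h⟩
    exact ⟨x, rfl, (congrArg (· - z • (x : H)) h).trans (add_sub_cancel_right _ _)⟩

theorem mem_nullSpace {T : H →ₗ.[ℂ] H} {x : H} : x ∈ nullSpace T ↔ (x, (0 : H)) ∈ T.graph := by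
  simp only [nullSpace, Submodule.mem_map, LinearMap.mem_ker, LinearPMap.mem_graph_iff]
  exact ⟨fun ⟨y, h, h'⟩ => ⟨y, h', h⟩, fun ⟨y, h, h'⟩ => ⟨y, h', h⟩⟩

theorem mem_rangeSpace {T : H →ₗ.[ℂ] H} {y : H} :
    y ∈ rangeSpace T ↔ ∃ u, (u, y) ∈ T.graph := by
  simp only [rangeSpace, LinearMap.mem_range, LinearPMap.mem_graph_iff]
  exact ⟨fun ⟨x, h⟩ => ⟨x, x, rfl, h⟩, fun ⟨_, x, _, h⟩ => ⟨x, h⟩⟩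

theorem mem_nullSpace_shift {T : H →ₗ.[ℂ] H} {z : ℂ} {x : H} :
    x ∈ nullSpace (shift T z) ↔ (x, z • x) ∈ T.graph := by
  rw [mem_nullSpace, mem_graph_shift, zero_add]

theorem mem_rangeSpace_shift {T : H →ₗ.[ℂ] H} {z : ℂ} {y : H} :
    y ∈ rangeSpace (shift T z) ↔ ∃ u, (u, y + z • u) ∈ T.graph := by
  simp only [mem_rangeSpace, mem_graph_shift]

theorem mem_pointSpec {T : H →ₗ.[ℂ] H} {z : ℂ} :
    z ∈ pointSpec T ↔ ∃ x, x ≠ 0 ∧ (x, z • x) ∈ T.graph := by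
  simp only [← mem_nullSpace_shift]
  have h : Function.Injective (shift T z) ↔ nullSpace (shift T z) = ⊥ :=
    LinearMap.ker_eq_bot.symm.trans (by
      rw [nullSpace, ← Submodule.map_bot (shift T z).domain.subtype,
        (Submodule.map_injective_of_injective (shift T z).domain.injective_subtype).eq_iff])
  change ¬ Function.Injective (shift T z) ↔ _
  rw [h]
  change nullSpace (shift T z) ≠ ⊥ ↔ _
  rw [Submodule.ne_bot_iff]
  exact ⟨fun ⟨x, h, h'⟩ => ⟨x, h', h⟩, fun ⟨x, h, h'⟩ => ⟨x, h', h⟩⟩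

theorem isClosed_shift {T : H →ₗ.[ℂ] H} (hT : T.IsClosed) (z : ℂ) : (shift T z).IsClosed := by
  have h : ((shift T z).graph : Set (H × H)) =
      (fun p : H × H => (p.1, p.2 + z • p.1)) ⁻¹' (T.graph : Set (H × H)) := by
    ext ⟨u, v⟩
    exact mem_graph_shift
  change IsClosed ((shift T z).graph : Set (H × H))
  rw [h]
  exact IsClosed.preimage (by fun_prop) hT

/-- `S` is the bounded inverse of `T - z I` on all of `H`, expressed through the graph of `T`. -/
def IsResolventAt (T : H →ₗ.[ℂ] H) (z : ℂ) (S : H →L[ℂ] H) : Prop :=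
  ∀ u v, (u, v) ∈ T.graph ↔ S (v - z • u) = u

theorem IsResolventAt.mem_graph {T : H →ₗ.[ℂ] H} {z : ℂ} {S : H →L[ℂ] H}
    (h : IsResolventAt T z S) (y : H) : (S y, y + z • S y) ∈ T.graph :=
  (h _ _).2 (by rw [add_sub_cancel_right])

theorem mem_resolvent {T : H →ₗ.[ℂ] H} {z : ℂ} :
    z ∈ resolvent T ↔ ∃ S, IsResolventAt T z S := by
  refine exists_congr fun S => ⟨fun ⟨h1, h2⟩ u v => ⟨fun h => ?_, fun h => ?_⟩,
    fun h => ⟨fun y => ?_, fun x => ?_⟩⟩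
  · obtain ⟨x, rfl, rfl⟩ := T.mem_graph_iff.1 h
    exact h2 x
  · obtain ⟨x, hx, hx'⟩ := h1 (v - z • u)
    rw [h] at hx
    have := (shift T z).mem_graph x
    rw [hx, hx', mem_graph_shift, sub_add_cancel] at this
    exact this
  · obtain ⟨x, hx, hx'⟩ := (shift T z).mem_graph_iff.1 (mem_graph_shift.2 (h.mem_graph y))
    exact ⟨x, hx, hx'⟩
  · exact (h _ _).1 (T.mem_graph x)

theorem IsResolventAt.sub_eq {T : H →ₗ.[ℂ] H} {z w : ℂ} {S R : H →L[ℂ] H}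
    (hS : IsResolventAt T z S) (hR : IsResolventAt T w R) : S - R = (z - w) • (S * R) := by
  ext y
  have h := (hS _ _).1 (hR.mem_graph y)
  have e : y + w • R y - z • R y = y - (z - w) • R y := by module
  rw [e, map_sub, map_smul] at h
  change S y - R y = (z - w) • S (R y)
  rw [sub_eq_iff_eq_add, add_comm, ← sub_eq_iff_eq_add]
  exact h

theorem IsParanormal.norm_sq_le {T : H →ₗ.[ℂ] H} (hT : IsParanormal T) {u v w : H}
    (h1 : (u, v) ∈ T.graph) (h2 : (v, w) ∈ T.graph) : ‖v‖ ^ 2 ≤ ‖w‖ * ‖u‖ := by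
  obtain ⟨x, rfl, rfl⟩ := T.mem_graph_iff.1 h1
  obtain ⟨y, hy, rfl⟩ := T.mem_graph_iff.1 h2
  obtain ⟨y, hy'⟩ := y
  obtain rfl : y = T x := hy
  exact hT x hy'

theorem IsSymm.isParanormal [CompleteSpace H] {T : H →ₗ.[ℂ] H} (hT : IsSymm T) :
    IsParanormal T := by
  intro x hx
  have hf : ∀ a b : T.domain, inner ℂ (T a) (b : H) = inner ℂ (a : H) (T b) := by
    intro a b
    have := T.adjoint_isFormalAdjoint hT.1 ⟨a, hT.2.1 a.2⟩ b
    rwa [← hT.2.2 (x := a) (y := ⟨a, hT.2.1 a.2⟩) rfl] at this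
  have h : ‖T x‖ ^ 2 = ‖inner ℂ (x : H) (T ⟨T x, hx⟩)‖ := by
    rw [← hf x ⟨T x, hx⟩, inner_self_eq_norm_sq_to_K]
    simp
  rw [h, mul_comm]
  exact norm_inner_le_norm _ _

variable [CompleteSpace H]

/-- A closed subspace of `H × H` that is the graph of the inverse of an everywhere defined linear
map is the graph of the inverse of a bounded one (closed graph theorem). -/
theorem exists_clm_of_isClosed (G : Submodule ℂ (H × H)) (hG : IsClosed (G : Set (H × H)))
    (inj : ∀ u, (u, (0 : H)) ∈ G → u = 0) (surj : ∀ y, ∃ u, (u, y) ∈ G) :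
    ∃ S : H →L[ℂ] H, ∀ u y, (u, y) ∈ G ↔ S y = u := by
  have : CompleteSpace G := hG.completeSpace_coe
  let p : G →L[ℂ] H := (ContinuousLinearMap.snd ℂ H H).comp G.subtypeL
  have hker : p.ker = ⊥ := by
    rw [LinearMap.ker_eq_bot']
    rintro ⟨⟨u, v⟩, h⟩ (rfl : v = 0)
    obtain rfl := inj u h
    rfl
  have hrange : p.range = ⊤ := by
    rw [LinearMap.range_eq_top]
    intro y
    obtain ⟨u, hu⟩ := surj y
    exact ⟨⟨(u, y), hu⟩, rfl⟩
  let e := ContinuousLinearEquiv.ofBijective p hker hrange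
  have he : ∀ g : G, e g = g.1.2 := fun g => rfl
  refine ⟨(ContinuousLinearMap.fst ℂ H H).comp (G.subtypeL.comp e.symm.toContinuousLinearMap),
    fun u y => ⟨fun h => ?_, fun h => ?_⟩⟩
  · have : e.symm y = ⟨(u, y), h⟩ := e.symm_apply_eq.2 rfl
    simp [this]
  · have h2 : (e.symm y).1.2 = y := by rw [← he, e.apply_symm_apply]
    have h3 : (e.symm y).1 = (u, y) := Prod.ext h h2
    exact h3 ▸ (e.symm y).2

theorem mem_resolvent_of_bijective {T : H →ₗ.[ℂ] H} (hT : T.IsClosed) {z : ℂ}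
    (inj : ∀ x, (x, z • x) ∈ T.graph → x = 0) (surj : ∀ y, ∃ u, (u, y + z • u) ∈ T.graph) :
    z ∈ resolvent T := by
  obtain ⟨S, hS⟩ := exists_clm_of_isClosed (shift T z).graph (isClosed_shift hT z)
    (fun u hu => inj u (by simpa using mem_graph_shift.1 hu))
    (fun y => (surj y).imp fun u hu => mem_graph_shift.2 hu)
  refine mem_resolvent.2 ⟨S, fun u v => ?_⟩
  rw [← hS, mem_graph_shift, sub_add_cancel]

/-! ### Log-convex sequences -/

/-- The ratios of a log-convex sequence increase, so exponential growth of rate at most `ρ` bounds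
already the first of them. -/
theorem le_mul_of_logConvex {a : ℕ → ℝ} {C ρ : ℝ} (h0 : ∀ n, 0 ≤ a n)
    (hc : ∀ n, a (n + 1) ^ 2 ≤ a (n + 2) * a n) (hρ : 0 < ρ) (hb : ∀ n, a n ≤ C * ρ ^ n) :
    a 1 ≤ ρ * a 0 := by
  by_contra! hlt
  have h1 : 0 < a 1 := (mul_nonneg hρ.le (h0 0)).trans_lt hlt
  have ha0 : 0 < a 0 := by
    refine (h0 0).lt_of_ne fun h => ?_
    have := hc 0
    rw [← h] at this
    simp only [zero_add, mul_zero] at this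
    nlinarith
  set t := a 1 / a 0 with ht
  have htρ : ρ < t := by rwa [ht, lt_div_iff₀ ha0]
  have ht0 : 0 < t := hρ.trans htρ
  have hstep : ∀ n, 0 < a n ∧ t * a n ≤ a (n + 1) := by
    intro n
    induction n with
    | zero => exact ⟨ha0, by rw [ht, div_mul_cancel₀ _ ha0.ne']⟩
    | succ n ih =>
      obtain ⟨h, h'⟩ := ih
      have hp : 0 < a (n + 1) := (mul_pos ht0 h).trans_le h'
      refine ⟨hp, le_of_mul_le_mul_right ?_ h⟩
      calc t * a (n + 1) * a n = a (n + 1) * (t * a n) := by ring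
        _ ≤ a (n + 1) * a (n + 1) := by gcongr
        _ = a (n + 1) ^ 2 := by ring
        _ ≤ _ := hc n
  have hpow : ∀ n, t ^ n * a 0 ≤ a n := by
    intro n
    induction n with
    | zero => simp
    | succ n ih =>
      calc t ^ (n + 1) * a 0 = t * (t ^ n * a 0) := by ring
        _ ≤ t * a n := by gcongr
        _ ≤ _ := (hstep n).2
  obtain ⟨n, hn⟩ := pow_unbounded_of_one_lt (C / a 0) ((one_lt_div hρ).2 htρ)
  rw [div_lt_iff₀ ha0, div_pow, div_mul_eq_mul_div, lt_div_iff₀ (pow_pos hρ n)] at hn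
  exact absurd ((hpow n).trans (hb n)) (not_le.2 hn)

end

section

variable {H : Type*} [NormedAddCommGroup H] [InnerProductSpace ℂ H]

/-! ### Eigenvectors of paranormal operators -/

/-- The powers of `T` applied to a combination of two eigenvectors form a log-convex sequence whose
growth rate is the larger eigenvalue, so `‖T v‖ ≤ |μ| ‖v‖` on the span. -/
theorem IsParanormal.norm_smul_add_smul_le {T : H →ₗ.[ℂ] H} (hT : IsParanormal T) {a b : ℂ}
    {x y : H} (hx : (x, a • x) ∈ T.graph) (hy : (y, b • y) ∈ T.graph) (hab : ‖a‖ ≤ ‖b‖)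
    (hb : b ≠ 0) : ‖a • x + b • y‖ ≤ ‖b‖ * ‖x + y‖ := by
  have hg : ∀ n : ℕ, (a ^ n • x + b ^ n • y, a ^ (n + 1) • x + b ^ (n + 1) • y) ∈ T.graph := by
    intro n
    have := T.graph.add_mem (T.graph.smul_mem (a ^ n) hx) (T.graph.smul_mem (b ^ n) hy)
    simpa [smul_smul, ← pow_succ] using this
  have := le_mul_of_logConvex (a := fun n => ‖a ^ n • x + b ^ n • y‖) (C := ‖x‖ + ‖y‖) (ρ := ‖b‖)
    (fun n => norm_nonneg _) (fun n => hT.norm_sq_le (hg n) (hg (n + 1))) (norm_pos_iff.2 hb)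
    (fun n => by
      calc _ ≤ ‖a ^ n • x‖ + ‖b ^ n • y‖ := norm_add_le _ _
        _ = ‖a‖ ^ n * ‖x‖ + ‖b‖ ^ n * ‖y‖ := by simp [norm_smul]
        _ ≤ ‖b‖ ^ n * ‖x‖ + ‖b‖ ^ n * ‖y‖ := by gcongr
        _ = _ := by ring)
  simpa using this

/-- Eigenvectors of a paranormal operator for distinct eigenvalues are orthogonal: on their span
`b⁻¹ T` is a contraction that fixes `y`. -/
theorem IsParanormal.inner_eq_zero_of_le {T : H →ₗ.[ℂ] H} (hT : IsParanormal T) {a b : ℂ}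
    {x y : H} (hx : (x, a • x) ∈ T.graph) (hy : (y, b • y) ∈ T.graph) (hab : ‖a‖ ≤ ‖b‖)
    (hne : a ≠ b) : inner ℂ x y = 0 := by
  have hb : b ≠ 0 := by
    rintro rfl
    exact hne (norm_le_zero_iff.1 (by simpa using hab))
  set q : ℂ := a / b with hq
  have hq1 : q ≠ 1 := by rwa [hq, Ne, div_eq_one_iff_eq hb]
  have hqa : a = b * q := by rw [hq, mul_div_cancel₀ _ hb]
  have hcontr : ∀ t : ℂ, ‖q • x + t • y‖ ≤ ‖x + t • y‖ := by
    intro t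
    have ht : (t • y, b • t • y) ∈ T.graph := by
      rw [smul_comm b t y]
      exact T.graph.smul_mem t hy
    have h := hT.norm_smul_add_smul_le hx ht hab hb
    have e : a • x + b • t • y = b • (q • x + t • y) := by rw [hqa]; module
    rw [e, norm_smul] at h
    exact le_of_mul_le_mul_left h (norm_pos_iff.2 hb)
  have hlin : ∀ t : ℂ, 2 * (inner ℂ ((q - 1) • x) (t • y)).re ≤ ‖x‖ ^ 2 := by
    intro t
    have h := pow_le_pow_left₀ (norm_nonneg _) (hcontr t) 2
    rw [@norm_add_sq ℂ, @norm_add_sq ℂ] at h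
    have e : inner ℂ ((q - 1) • x) (t • y) = inner ℂ (q • x) (t • y) - inner ℂ x (t • y) := by
      rw [← inner_sub_left]; congr 1; module
    rw [e, Complex.sub_re]
    have := sq_nonneg ‖q • x‖
    simp only [RCLike.re_to_complex] at h
    linarith
  set c := inner ℂ ((q - 1) • x) y with hc
  have hc0 : c = 0 := by
    by_contra hne0
    have h := hlin (((‖x‖ ^ 2 + 1 : ℝ) : ℂ) / c)
    rw [inner_smul_right, div_mul_cancel₀ _ hne0, Complex.ofReal_re] at h
    nlinarith [sq_nonneg ‖x‖]
  rw [hc, inner_smul_left] at hc0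
  rcases mul_eq_zero.1 hc0 with h | h
  · exact absurd (sub_eq_zero.1 ((map_eq_zero _).1 h)) hq1
  · exact h

theorem IsParanormal.inner_eq_zero {T : H →ₗ.[ℂ] H} (hT : IsParanormal T) {a b : ℂ}
    {x y : H} (hx : (x, a • x) ∈ T.graph) (hy : (y, b • y) ∈ T.graph)
    (hne : a ≠ b) : inner ℂ x y = 0 := by
  rcases le_total ‖a‖ ‖b‖ with h | h
  · exact hT.inner_eq_zero_of_le hx hy h hne
  · exact inner_eq_zero_symm.1 (hT.inner_eq_zero_of_le hy hx h hne.symm)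

/-! ### Fredholm operators of index zero -/

/-- If `K` has finite rank and `1 - K` is injective, then `1 - K` is surjective. -/
theorem _root_.LinearMap.surjective_one_sub_of_finiteDimensional_range {V : Type*}
    [AddCommGroup V] [Module ℂ V] (K : V →ₗ[ℂ] V) [FiniteDimensional ℂ (LinearMap.range K)]
    (hK : ∀ x, K x = x → x = 0) (y : V) : ∃ x, x - K x = y := by
  let L : LinearMap.range K →ₗ[ℂ] LinearMap.range K :=
    LinearMap.id - K.rangeRestrict ∘ₗ (LinearMap.range K).subtype
  have hL : ∀ v, ((L v : LinearMap.range K) : V) = v - K v := fun v => rfl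
  have hinj : Function.Injective L := by
    rw [← LinearMap.ker_eq_bot, LinearMap.ker_eq_bot']
    intro v hv
    refine Subtype.ext (hK v ?_)
    have := hL v
    rw [hv] at this
    exact (sub_eq_zero.1 this.symm).symm
  obtain ⟨v, hv⟩ := LinearMap.injective_iff_surjective.1 hinj ⟨K y, y, rfl⟩
  have h := hL v
  rw [hv] at h
  refine ⟨y + v, ?_⟩
  rw [map_add]
  change K y = v - K v at h
  rw [h]
  abel

variable [CompleteSpace H]

/-- A Fredholm operator of index zero becomes boundedly invertible, with inverse `B`, after adding
the finite rank operator `F` that maps `N(T)` onto `R(T)ᗮ` and vanishes on `N(T)ᗮ`. -/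
theorem IsFredholm.exists_finiteRank {A : H →ₗ.[ℂ] H} (hA : IsFredholm A) (h0 : index A = 0) :
    ∃ F B : H →L[ℂ] H, FiniteDimensional ℂ (LinearMap.range (F : H →ₗ[ℂ] H)) ∧
      (∀ x ∈ (nullSpace A)ᗮ, F x = 0) ∧
      ∀ u v, (u, v) ∈ A.graph ↔ B (v + F u) = u := by
  have := hA.finite_null
  have := hA.finite_corange
  have hfin : Module.finrank ℂ (nullSpace A) = Module.finrank ℂ (rangeSpace A)ᗮ := by
    have := h0
    unfold index at this
    omega
  let J : nullSpace A ≃ₗ[ℂ] (rangeSpace A)ᗮ := LinearEquiv.ofFinrankEq _ _ hfin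
  let F : H →L[ℂ] H := (rangeSpace A)ᗮ.subtypeL.comp
    ((LinearMap.toContinuousLinearMap (J : nullSpace A →ₗ[ℂ] (rangeSpace A)ᗮ)).comp
      (nullSpace A).orthogonalProjectionOnto)
  have hF : ∀ x, F x = J ((nullSpace A).orthogonalProjectionOnto x) := fun x => rfl
  have hFmem : ∀ x, F x ∈ (rangeSpace A)ᗮ := fun x => by rw [hF]; exact Submodule.coe_mem _
  let s : H × H →L[ℂ] H × H := (ContinuousLinearMap.fst ℂ H H).prod
    (ContinuousLinearMap.snd ℂ H H - F.comp (ContinuousLinearMap.fst ℂ H H))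
  let G : Submodule ℂ (H × H) := A.graph.comap (s : H × H →ₗ[ℂ] H × H)
  have hG : ∀ u v, (u, v) ∈ G ↔ (u, v - F u) ∈ A.graph := fun u v => Iff.rfl
  obtain ⟨B, hB⟩ := exists_clm_of_isClosed G (hA.closed.preimage s.continuous)
    (fun u hu => by
      rw [hG, zero_sub] at hu
      have h1 : F u = 0 := by
        have h2 : -F u ∈ rangeSpace A := mem_rangeSpace.2 ⟨u, hu⟩
        have h3 := (rangeSpace A).inner_right_of_mem_orthogonal h2 (hFmem u)
        rw [inner_neg_left, neg_eq_zero, inner_self_eq_zero] at h3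
        exact h3
      rw [h1, neg_zero] at hu
      have h4 : (nullSpace A).orthogonalProjectionOnto u = 0 := by
        rw [hF] at h1
        exact J.map_eq_zero_iff.1 (Subtype.ext h1)
      have h5 := (nullSpace A).orthogonalProjectionOnto_mem_subspace_eq_self ⟨u, mem_nullSpace.2 hu⟩
      rw [h4] at h5
      exact (congrArg Subtype.val h5).symm)
    (fun y => by
      have := hA.closed_range.completeSpace_coe
      obtain ⟨r, hr, q, hq, rfl⟩ := (rangeSpace A).exists_add_mem_mem_orthogonal y
      obtain ⟨u, hu⟩ := mem_rangeSpace.1 hr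
      let P := (nullSpace A).orthogonalProjectionOnto
      let n : nullSpace A := J.symm ⟨q, hq⟩ - P u
      refine ⟨u + n, ?_⟩
      have hPn : P (u + n) = J.symm ⟨q, hq⟩ := by
        rw [map_add, (nullSpace A).orthogonalProjectionOnto_mem_subspace_eq_self]
        simp [n]
      have hFn : F (u + n) = q := by
        rw [hF]
        change ((J (P (u + n)) : (rangeSpace A)ᗮ) : H) = q
        rw [hPn, J.apply_symm_apply]
      rw [hG, hFn, add_sub_cancel_right]
      simpa using A.graph.add_mem hu (mem_nullSpace.1 n.2))
  refine ⟨F, B, ?_, fun x hx => ?_, fun u v => ?_⟩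
  · refine Submodule.finiteDimensional_of_le (S₂ := (rangeSpace A)ᗮ) ?_
    rintro _ ⟨x, rfl⟩
    exact hFmem x
  · rw [hF, Submodule.orthogonalProjectionOnto_apply_of_mem_orthogonal hx, map_zero]
    rfl
  · rw [← hB, hG, add_sub_cancel_right]

/-- Stability of the index: if `T - z I + F` has the bounded inverse `B`, `F` has finite rank and
`w` is close to `z`, then `T - w I` is invertible as soon as it is injective. -/
theorem mem_resolvent_of_finiteRank {T : H →ₗ.[ℂ] H} (hT : T.IsClosed) {z w : ℂ}
    {F B : H →L[ℂ] H} [FiniteDimensional ℂ (LinearMap.range (F : H →ₗ[ℂ] H))]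
    (hB : ∀ u v, (u, v) ∈ (shift T z).graph ↔ B (v + F u) = u) (hw : ‖(w - z) • B‖ < 1)
    (inj : ∀ x, (x, w • x) ∈ T.graph → x = 0) : w ∈ resolvent T := by
  refine mem_resolvent_of_bijective hT inj fun y => ?_
  let C := Units.oneSub ((w - z) • B) hw
  let D : H →L[ℂ] H := B * (↑C⁻¹ : H →L[ℂ] H)
  have hC : ∀ y, (↑C⁻¹ : H →L[ℂ] H) y = y + (w - z) • D y := by
    intro y
    have h := congrArg (fun S : H →L[ℂ] H => S y) C.mul_inv
    change (↑C⁻¹ : H →L[ℂ] H) y - (w - z) • D y = y at h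
    exact sub_eq_iff_eq_add.1 h
  have hD : ∀ y, (D y, y - F (D y) + w • D y) ∈ T.graph := by
    intro y
    have h := (hB (D y) (y + (w - z) • D y - F (D y))).2 (by
      rw [sub_add_cancel, ← hC]; rfl)
    rw [mem_graph_shift] at h
    convert h using 2
    module
  let K : H →ₗ[ℂ] H := (F : H →ₗ[ℂ] H) ∘ₗ (D : H →ₗ[ℂ] H)
  have : FiniteDimensional ℂ (LinearMap.range K) :=
    Submodule.finiteDimensional_of_le (LinearMap.range_comp_le_range _ _)
  obtain ⟨y', hy'⟩ := K.surjective_one_sub_of_finiteDimensional_range (fun x hx => by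
    change F (D x) = x at hx
    have h := hD x
    rw [hx, sub_self, zero_add] at h
    rw [← hx, inj _ h, map_zero]) y
  refine ⟨D y', ?_⟩
  rw [← hy']
  exact hD y'

/-- For a paranormal operator, `σ(T) \ ω(T) ⊆ π₀₀(T)`: near a Fredholm point `z` of index zero an
eigenvector for another eigenvalue would be orthogonal to `N(T - z I)`, where `T - z I` is bounded
below. -/
theorem IsParanormal.spec_diff_weylSpec_subset {T : H →ₗ.[ℂ] H} (hT : T.IsClosed)
    (hp : IsParanormal T) : spec T \ weylSpec T ⊆ piZeroZero T := by
  rintro z ⟨hz, hz'⟩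
  obtain ⟨hF, h0⟩ := not_not.1 hz'
  obtain ⟨F, B, hfin, hFz, hB⟩ := hF.exists_finiteRank h0
  refine ⟨?_, ?_, hF.finite_null⟩
  · rw [mem_pointSpec]
    by_contra! h
    refine hz (mem_resolvent_of_finiteRank hT hB (by simp) fun x hx => ?_)
    by_contra hx0
    exact h x hx0 hx
  · have hpos : 0 < ‖B‖ + 1 := by positivity
    refine ⟨(‖B‖ + 1)⁻¹, inv_pos.2 hpos, Set.Subset.antisymm ?_ ?_⟩
    · rintro w ⟨hw, hws⟩
      by_contra hne
      have hw1 : ‖(w - z) • B‖ < 1 := by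
        rw [mem_closedBall_iff_norm] at hw
        rw [norm_smul]
        calc ‖w - z‖ * ‖B‖ ≤ (‖B‖ + 1)⁻¹ * ‖B‖ := by gcongr
          _ < (‖B‖ + 1)⁻¹ * (‖B‖ + 1) := by gcongr; linarith
          _ = 1 := inv_mul_cancel₀ hpos.ne'
      refine hws (mem_resolvent_of_finiteRank hT hB hw1 fun x hx => ?_)
      have hxo : x ∈ (nullSpace (shift T z))ᗮ := by
        rw [Submodule.mem_orthogonal]
        intro y hy
        exact hp.inner_eq_zero (mem_nullSpace_shift.1 hy) hx (Ne.symm hne)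
      have h := (hB x ((w - z) • x)).1 (by
        rw [mem_graph_shift]; convert hx using 2; module)
      rw [hFz x hxo, add_zero] at h
      have h2 : ‖x‖ ≤ ‖(w - z) • B‖ * ‖x‖ := by
        calc ‖x‖ = ‖((w - z) • B) x‖ := congrArg norm (h.symm.trans (map_smul B (w - z) x))
          _ ≤ _ := ContinuousLinearMap.le_opNorm _ _
      by_contra hx0
      have := norm_pos_iff.2 hx0
      nlinarith
    · rintro _ rfl
      exact ⟨Metric.mem_closedBall_self (inv_pos.2 hpos).le, hz⟩

end

section

variable {H : Type*} [NormedAddCommGroup H] [InnerProductSpace ℂ H]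

/-! ### Contour integrals of the resolvent -/

variable [CompleteSpace H]

/-- `R` is the resolvent function of `T` on the punctured disc of radius `r` about `c`. -/
def IsResolventOn (T : H →ₗ.[ℂ] H) (c : ℂ) (r : ℝ) (R : ℂ → H →L[ℂ] H) : Prop :=
  ∀ z ∈ ball c r \ {c}, IsResolventAt T z (R z)

/-- The vector `∮ f(z) (T - z I)⁻¹ x dz` over the circle of radius `s` about `c`, that is
`-2πi f(T) x` of the holomorphic functional calculus on the spectral subspace of `c`. -/
noncomputable def resolventIntegral (R : ℂ → H →L[ℂ] H) (c : ℂ) (s : ℝ) (f : ℂ → ℂ) (x : H) : H :=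
  ∮ z in C(c, s), f z • R z x

theorem sphere_subset_punctured {c : ℂ} {r s : ℝ} (hs : 0 < s) (hsr : s < r) :
    sphere c s ⊆ ball c r \ {c} := by
  intro z hz
  rw [mem_sphere] at hz
  refine ⟨by rw [mem_ball, hz]; exact hsr, ?_⟩
  rintro rfl
  rw [dist_self] at hz
  exact hs.ne hz

section

variable {T : H →ₗ.[ℂ] H} {c : ℂ} {r s t : ℝ} {R : ℂ → H →L[ℂ] H} {f g : ℂ → ℂ} {x : H}

theorem isOpen_punctured (c : ℂ) (r : ℝ) : IsOpen (ball c r \ {c}) :=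
  isOpen_ball.sdiff isClosed_singleton

theorem IsResolventOn.differentiableAt (hR : IsResolventOn T c r R) {z : ℂ}
    (hz : z ∈ ball c r \ {c}) : DifferentiableAt ℂ R z := by
  have hd : DifferentiableAt ℂ (fun w : ℂ => R z * Ring.inverse (1 - (w - z) • R z)) z := by
    refine (differentiableAt_const _).mul (DifferentiableAt.comp z (g := Ring.inverse)
      (differentiableAt_inverse ?_) (by fun_prop))
    simp
  refine hd.congr_of_eventuallyEq ?_
  have hu : ∀ᶠ w in nhds z, IsUnit (1 - (w - z) • R z) := by
    have hcont : ContinuousAt (fun w : ℂ => 1 - (w - z) • R z) z := by fun_prop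
    refine hcont.eventually (Units.isOpen.mem_nhds ?_)
    simp
  filter_upwards [hu, (isOpen_punctured c r).mem_nhds hz] with w hw hwr
  have h := (hR w hwr).sub_eq (hR z hz)
  -- the resolvent identity, solved for `R w` in terms of `R z`
  have e : R w * (1 - (w - z) • R z) = R z := by
    rw [mul_sub, mul_one, mul_smul_comm, ← h]
    abel
  rw [Ring.eq_mul_inverse_iff_mul_eq _ _ _ hw]
  exact e

theorem IsResolventOn.continuousOn (hR : IsResolventOn T c r R) :
    ContinuousOn R (ball c r \ {c}) :=
  fun _ hz => (hR.differentiableAt hz).continuousAt.continuousWithinAt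

theorem IsResolventOn.circleIntegrable (hR : IsResolventOn T c r R) (hs : 0 < s) (hsr : s < r)
    (hf : ContinuousOn f (sphere c s)) (x : H) :
    CircleIntegrable (fun z => f z • R z x) c s := by
  refine ContinuousOn.circleIntegrable hs.le (hf.smul ?_)
  exact (hR.continuousOn.mono (sphere_subset_punctured hs hsr)).clm_apply continuousOn_const

theorem IsResolventOn.integral_add (hR : IsResolventOn T c r R) (hs : 0 < s) (hsr : s < r)
    (hf : ContinuousOn f (sphere c s)) (hg : ContinuousOn g (sphere c s)) (x : H) :
    resolventIntegral R c s (fun z => f z + g z) x =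
      resolventIntegral R c s f x + resolventIntegral R c s g x := by
  simp only [resolventIntegral, add_smul]
  exact circleIntegral.integral_add (hR.circleIntegrable hs hsr hf x)
    (hR.circleIntegrable hs hsr hg x)

omit [CompleteSpace H] in
theorem resolventIntegral_const_mul (R : ℂ → H →L[ℂ] H) (c : ℂ) (s : ℝ) (a : ℂ) (f : ℂ → ℂ)
    (x : H) : resolventIntegral R c s (fun z => a * f z) x = a • resolventIntegral R c s f x := by
  simp only [resolventIntegral, mul_smul]
  exact circleIntegral.integral_smul a _ _ _

omit [CompleteSpace H] in
theorem resolventIntegral_congr (R : ℂ → H →L[ℂ] H) (hs : 0 ≤ s) (h : Set.EqOn f g (sphere c s))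
    (x : H) : resolventIntegral R c s f x = resolventIntegral R c s g x :=
  circleIntegral.integral_congr hs fun z hz => by simp only [h hz]

/-- By Cauchy's theorem on an annulus the radius does not matter. -/
theorem IsResolventOn.integral_radius (hR : IsResolventOn T c r R)
    (hf : DifferentiableOn ℂ f (ball c r)) (hs : 0 < s) (hst : s ≤ t) (htr : t < r) (x : H) :
    resolventIntegral R c t f x = resolventIntegral R c s f x := by
  have hd : ∀ z ∈ ball c r \ {c}, DifferentiableAt ℂ (fun z => f z • R z x) z := fun z hz =>
    (hf.differentiableAt (isOpen_ball.mem_nhds hz.1)).smul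
      ((hR.differentiableAt hz).clm_apply (differentiableAt_const _))
  refine Complex.circleIntegral_eq_of_differentiable_on_annulus_off_countable hs hst
    Set.countable_empty (fun z hz => ?_) (fun z hz => ?_)
  · refine (hd z ⟨closedBall_subset_ball htr hz.1, ?_⟩).continuousAt.continuousWithinAt
    rintro rfl
    exact hz.2 (mem_ball_self hs)
  · refine hd z ⟨ball_subset_ball htr.le hz.1.1, ?_⟩
    rintro rfl
    exact hz.1.2 (mem_closedBall_self hs.le)

theorem continuousOn_sphere (hf : DifferentiableOn ℂ f (ball c r)) (hsr : s < r) :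
    ContinuousOn f (sphere c s) :=
  hf.continuousOn.mono (sphere_subset_closedBall.trans (closedBall_subset_ball hsr))

theorem circleIntegral_eq_zero (hf : DifferentiableOn ℂ f (ball c r)) (hs : 0 ≤ s) (hsr : s < r) :
    (∮ z in C(c, s), f z) = 0 :=
  Complex.circleIntegral_eq_zero_of_differentiable_on_off_countable hs Set.countable_empty
    (hf.continuousOn.mono (closedBall_subset_ball hsr))
    fun _ hz => hf.differentiableAt (isOpen_ball.mem_nhds (ball_subset_ball hsr.le hz.1))

theorem _root_.ContinuousLinearMap.circleIntegral_comp_comm {E F : Type*}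
    [NormedAddCommGroup E] [NormedSpace ℂ E] [CompleteSpace E] [NormedAddCommGroup F]
    [NormedSpace ℂ F] [CompleteSpace F] (L : E →L[ℂ] F) {φ : ℂ → E} {c : ℂ} {s : ℝ}
    (hφ : CircleIntegrable φ c s) : (∮ z in C(c, s), L (φ z)) = L (∮ z in C(c, s), φ z) := by
  simp only [circleIntegral, ← map_smul]
  exact L.intervalIntegral_comp_comm hφ.out

/-- Since `T - w I` has a bounded inverse for some `w`, the closed operator `T` can be taken under
the integral sign: `T ∮ f(z) R(z) x dz = ∮ f(z) dz x + ∮ z f(z) R(z) x dz`. -/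
theorem IsResolventOn.integral_mem_graph (hR : IsResolventOn T c r R) (hs : 0 < s) (hsr : s < r)
    (hf : ContinuousOn f (sphere c s)) (x : H) :
    (resolventIntegral R c s f x,
      (∮ z in C(c, s), f z) • x + resolventIntegral R c s (fun z => z * f z) x) ∈ T.graph := by
  obtain ⟨w, hw⟩ : (sphere c s).Nonempty := NormedSpace.sphere_nonempty.2 hs.le
  have hwR := hR w (sphere_subset_punctured hs hsr hw)
  have hzf : ContinuousOn (fun z => z * f z) (sphere c s) := continuousOn_id.mul hf
  have i1 := hR.circleIntegrable hs hsr hf x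
  have i2 := hR.circleIntegrable hs hsr hzf x
  have i3 : CircleIntegrable (fun z => f z • x) c s :=
    (hf.smul continuousOn_const).circleIntegrable hs.le
  have i4 : CircleIntegrable (fun z => w • f z • R z x) c s := by
    simpa only [mul_smul] using
      hR.circleIntegrable hs hsr (f := fun z => w * f z) (continuousOn_const.mul hf) x
  have i5 : CircleIntegrable (fun z => f z • x + (z * f z) • R z x) c s := i3.add i2
  have i6 : CircleIntegrable (fun z => f z • x + (z * f z) • R z x - w • f z • R z x) c s :=
    i5.sub i4
  rw [hwR]
  have e : (∮ z in C(c, s), f z) • x + resolventIntegral R c s (fun z => z * f z) x -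
      w • resolventIntegral R c s f x =
      ∮ z in C(c, s), (f z • x + (z * f z) • R z x - w • f z • R z x) := by
    rw [circleIntegral.integral_sub i5 i4, circleIntegral.integral_add i3 i2,
      circleIntegral.integral_smul_const, circleIntegral.integral_smul]
    rfl
  rw [e, ← ContinuousLinearMap.circleIntegral_comp_comm _ i6]
  refine circleIntegral.integral_congr hs.le fun z hz => ?_
  have h := (hwR _ _).1 ((hR z (sphere_subset_punctured hs hsr hz)).mem_graph x)
  calc R w (f z • x + (z * f z) • R z x - w • f z • R z x)
      = R w (f z • (x + z • R z x - w • R z x)) := by congr 1; module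
    _ = f z • R z x := by rw [map_smul, h]

theorem IsResolventOn.integral_mem_graph_of_differentiableOn (hR : IsResolventOn T c r R)
    (hs : 0 < s) (hsr : s < r) (hf : DifferentiableOn ℂ f (ball c r)) (x : H) :
    (resolventIntegral R c s f x, resolventIntegral R c s (fun z => z * f z) x) ∈ T.graph := by
  have h := hR.integral_mem_graph hs hsr (continuousOn_sphere hf hsr) x
  rwa [circleIntegral_eq_zero hf hs.le hsr, zero_smul, zero_add] at h

theorem IsResolventOn.exists_norm_integral_pow_le (hR : IsResolventOn T c r R)
    (hsr : s < r) (ht : 0 < t) (hts : t ≤ s) {q : ℂ → ℂ}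
    (hf : DifferentiableOn ℂ f (ball c r)) (hq : DifferentiableOn ℂ q (ball c r)) {ρ : ℝ}
    (hρ : ∀ z ∈ sphere c t, ‖q z‖ ≤ ρ) (x : H) :
    ∃ C, ∀ n : ℕ, ‖resolventIntegral R c s (fun z => q z ^ n * f z) x‖ ≤ C * ρ ^ n := by
  have hcont : ContinuousOn (fun z => f z • R z x) (sphere c t) :=
    (continuousOn_sphere hf (hts.trans_lt hsr)).smul
      ((hR.continuousOn.mono (sphere_subset_punctured ht (hts.trans_lt hsr))).clm_apply
        continuousOn_const)
  obtain ⟨M, hM⟩ := (isCompact_sphere c t).exists_bound_of_continuousOn hcont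
  refine ⟨2 * Real.pi * t * M, fun n => ?_⟩
  rw [hR.integral_radius (f := fun z => q z ^ n * f z) ((hq.pow n).mul hf) ht hts hsr]
  calc _ ≤ 2 * Real.pi * t * (ρ ^ n * M) :=
        circleIntegral.norm_integral_le_of_norm_le_const ht.le fun z hz => by
          rw [mul_smul, norm_smul, norm_pow]
          exact mul_le_mul (pow_le_pow_left₀ (norm_nonneg _) (hρ z hz) n) (hM z hz)
            (norm_nonneg _) (pow_nonneg ((norm_nonneg _).trans (hρ z hz)) n)
    _ = _ := by ring

/-- If the iterates `qⁿ(T)` act log-convexly, then `q(T)` is bounded by the supremum of `|q|` on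
any smaller circle. -/
theorem IsResolventOn.norm_integral_mul_le (hR : IsResolventOn T c r R)
    (hsr : s < r) (ht : 0 < t) (hts : t ≤ s) {q : ℂ → ℂ}
    (hf : DifferentiableOn ℂ f (ball c r)) (hq : DifferentiableOn ℂ q (ball c r)) {ρ : ℝ}
    (hρ0 : 0 < ρ) (hρ : ∀ z ∈ sphere c t, ‖q z‖ ≤ ρ) (x : H)
    (hc : ∀ n : ℕ, ‖resolventIntegral R c s (fun z => q z ^ (n + 1) * f z) x‖ ^ 2 ≤
      ‖resolventIntegral R c s (fun z => q z ^ (n + 2) * f z) x‖ *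
        ‖resolventIntegral R c s (fun z => q z ^ n * f z) x‖) :
    ‖resolventIntegral R c s (fun z => q z * f z) x‖ ≤ ρ * ‖resolventIntegral R c s f x‖ := by
  obtain ⟨C, hC⟩ := hR.exists_norm_integral_pow_le hsr ht hts hf hq hρ x
  simpa using le_mul_of_logConvex (fun n => norm_nonneg _) hc hρ0 hC

end

end

section

variable {H : Type*} [NormedAddCommGroup H] [InnerProductSpace ℂ H]

/-! ### Paranormal operators at isolated points of the spectrum -/

/-- With `p₀ = y`, `p₁ = T y` and `p₂ = T² y`: if `T` is `|c|` times an isometry, then `T - c I` is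
paranormal. -/
theorem norm_sub_smul_sq_le {c : ℂ} {p₀ p₁ p₂ : H} (h1 : ‖p₁‖ = ‖c‖ * ‖p₀‖)
    (h2 : ‖p₂‖ = ‖c‖ * ‖p₁‖) (h3 : ‖p₂ - c • p₁‖ = ‖c‖ * ‖p₁ - c • p₀‖) :
    ‖p₁ - c • p₀‖ ^ 2 ≤ ‖p₂ - c • p₁ - c • (p₁ - c • p₀)‖ * ‖p₀‖ := by
  rcases eq_or_ne c 0 with rfl | hc
  · simp only [norm_zero, zero_mul] at h1
    simp only [zero_smul, sub_zero, h1, ne_eq, OfNat.ofNat_ne_zero, not_false_eq_true, zero_pow]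
    exact mul_nonneg (norm_nonneg _) (norm_nonneg _)
  have hc' : 0 < ‖c‖ := norm_pos_iff.2 hc
  set d := p₁ - c • p₀ with hd
  set e := p₂ - c • p₁ - c • d with he
  have e1 : ‖p₂‖ ^ 2 = ‖(p₂ - c • p₁) + c • p₁‖ ^ 2 := by rw [sub_add_cancel]
  have e2 : ‖p₁‖ ^ 2 = ‖d + c • p₀‖ ^ 2 := by rw [hd, sub_add_cancel]
  rw [@norm_add_sq ℂ, norm_smul, h2, h3] at e1
  rw [@norm_add_sq ℂ, norm_smul, h1] at e2
  -- `p₂ - c p₁ = c d + e` and `p₁ = d + c p₀`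
  have e3 : inner ℂ (p₂ - c • p₁) (c • p₁) =
      ((‖c‖ ^ 2 : ℝ) : ℂ) * (inner ℂ d d + inner ℂ d (c • p₀)) + inner ℂ e (c • p₁) := by
    have h : p₂ - c • p₁ = c • d + e := by rw [he]; abel
    have h' : inner ℂ (c • d) (c • p₁) = ((‖c‖ ^ 2 : ℝ) : ℂ) * inner ℂ d p₁ := by
      rw [inner_smul_left, inner_smul_right, ← mul_assoc, Complex.conj_mul', Complex.ofReal_pow]
    have h'' : p₁ = d + c • p₀ := by rw [hd, sub_add_cancel]
    rw [h, inner_add_left, h', ← inner_add_right, ← h'']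
  have e4 : (inner ℂ d d).re = ‖d‖ ^ 2 := inner_self_eq_norm_sq (𝕜 := ℂ) d
  simp only [RCLike.re_to_complex] at e1 e2
  rw [e3, Complex.add_re, Complex.re_ofReal_mul, Complex.add_re, e4] at e1
  have e5 : -(‖e‖ * (‖c‖ * (‖c‖ * ‖p₀‖))) ≤ (inner ℂ e (c • p₁)).re := by
    have h := (abs_le.1 ((Complex.abs_re_le_norm _).trans
      (norm_inner_le_norm (𝕜 := ℂ) e (c • p₁)))).1
    rwa [norm_smul, h1] at h
  refine le_of_mul_le_mul_left ?_ (pow_pos hc' 2)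
  have e6 : (inner ℂ d (c • p₀)).re = -(‖d‖ ^ 2 / 2) := by linarith
  rw [e6] at e1
  nlinarith

variable [CompleteSpace H] {T : H →ₗ.[ℂ] H} {c : ℂ} {r s : ℝ} {R : ℂ → H →L[ℂ] H} {f : ℂ → ℂ}

theorem IsParanormal.norm_integral_sq_le (hp : IsParanormal T) (hR : IsResolventOn T c r R)
    (hs : 0 < s) (hsr : s < r) (hf : DifferentiableOn ℂ f (ball c r)) (x : H) :
    ‖resolventIntegral R c s (fun z => z * f z) x‖ ^ 2 ≤
      ‖resolventIntegral R c s (fun z => z * (z * f z)) x‖ * ‖resolventIntegral R c s f x‖ :=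
  hp.norm_sq_le (hR.integral_mem_graph_of_differentiableOn hs hsr hf x)
    (hR.integral_mem_graph_of_differentiableOn hs hsr (f := fun z => z * f z)
      (differentiableOn_id.mul hf) x)

theorem norm_le_of_mem_sphere {z : ℂ} {t : ℝ} (hz : z ∈ sphere c t) : ‖z‖ ≤ ‖c‖ + t := by
  have h := norm_add_le c (z - c)
  rwa [add_sub_cancel, mem_sphere_iff_norm.1 hz] at h

theorem le_norm_of_mem_sphere {z : ℂ} {t : ℝ} (hz : z ∈ sphere c t) : ‖c‖ - t ≤ ‖z‖ := by
  have h := norm_sub_norm_le c z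
  rw [norm_sub_rev, mem_sphere_iff_norm.1 hz] at h
  linarith

/-- An inequality that holds for all small `t > 0` and is continuous at `0` holds at `0`. -/
theorem le_of_forall_small {a b : ℝ} {φ : ℝ → ℝ} (hφ : ContinuousAt φ 0) (hs : 0 < s)
    (h : ∀ t, 0 < t → t ≤ s → a ≤ φ t * b) : a ≤ φ 0 * b := by
  refine ge_of_tendsto (((hφ.mul continuousAt_const).mono_left
    (nhdsWithin_le_nhds (s := Set.Ioi 0))) : Filter.Tendsto _ _ _) ?_
  filter_upwards [Ioc_mem_nhdsGT hs] with t ht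
  exact h t ht.1 ht.2

theorem IsParanormal.norm_integral_mul_le (hp : IsParanormal T) (hR : IsResolventOn T c r R)
    (hs : 0 < s) (hsr : s < r) (hf : DifferentiableOn ℂ f (ball c r)) (x : H) :
    ‖resolventIntegral R c s (fun z => z * f z) x‖ ≤ ‖c‖ * ‖resolventIntegral R c s f x‖ := by
  have h := le_of_forall_small (φ := fun t => ‖c‖ + t) (by fun_prop) hs fun t ht hts =>
    hR.norm_integral_mul_le hsr ht hts hf differentiableOn_id
      (by positivity : 0 < ‖c‖ + t) (fun z hz => norm_le_of_mem_sphere hz) x fun n => by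
        have h := hp.norm_integral_sq_le hR hs hsr (f := fun z => z ^ n * f z)
          ((differentiableOn_id.pow n).mul hf) x
        simpa only [id, ← mul_assoc, ← pow_succ'] using h
  simpa using h

/-- The backward iterates `z⁻ⁿ` give the reverse inequality, so `T` acts as `|c|` times an isometry
on the spectral subspace of `c`. -/
theorem IsParanormal.norm_integral_mul_eq (hp : IsParanormal T) (hR : IsResolventOn T c r R)
    (hs : 0 < s) (hsr : s < r) (hrc : c = 0 ∨ r ≤ ‖c‖) (hf : DifferentiableOn ℂ f (ball c r))
    (x : H) :
    ‖resolventIntegral R c s (fun z => z * f z) x‖ = ‖c‖ * ‖resolventIntegral R c s f x‖ := by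
  refine le_antisymm (hp.norm_integral_mul_le hR hs hsr hf x) ?_
  rcases hrc with rfl | hrc
  · simp
  have hne : ∀ z ∈ ball c r, z ≠ 0 := by
    rintro _ hz rfl
    rw [mem_ball, dist_zero_left] at hz
    exact hrc.not_gt hz
  have hc0 : 0 < ‖c‖ := (hs.trans hsr).trans_le hrc
  have hsph : ∀ z ∈ sphere c s, z ≠ 0 := fun z hz =>
    hne z (sphere_subset_punctured hs hsr hz).1
  have hzf : DifferentiableOn ℂ (fun z => z * f z) (ball c r) := differentiableOn_id.mul hf
  have hinv : DifferentiableOn ℂ (fun z : ℂ => z⁻¹) (ball c r) :=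
    differentiableOn_id.inv hne
  have e0 : resolventIntegral R c s (fun z => z⁻¹ * (z * f z)) x = resolventIntegral R c s f x :=
    resolventIntegral_congr R hs.le (fun z hz => by
      simp only [inv_mul_cancel_left₀ (hsph z hz)]) x
  have h := le_of_forall_small (φ := fun t => (‖c‖ - t)⁻¹)
    (ContinuousAt.inv₀ (by fun_prop) (by simpa using hc0.ne')) hs fun t ht hts => by
      have hct : 0 < ‖c‖ - t := by linarith
      refine hR.norm_integral_mul_le hsr ht hts hzf hinv (inv_pos.2 hct) (fun z hz => ?_) x
        fun n => ?_
      · rw [norm_inv]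
        exact inv_anti₀ hct (le_norm_of_mem_sphere hz)
      · have h := hp.norm_integral_sq_le hR hs hsr (f := fun z => z⁻¹ ^ (n + 2) * (z * f z))
          ((hinv.pow (n + 2)).mul hzf) x
        have e1 : resolventIntegral R c s (fun z => z * (z⁻¹ ^ (n + 2) * (z * f z))) x =
            resolventIntegral R c s (fun z => z⁻¹ ^ (n + 1) * (z * f z)) x :=
          resolventIntegral_congr R hs.le (fun z hz => by
            have h1 := mul_inv_cancel₀ (hsph z hz)
            generalize z⁻¹ = w at h1 ⊢
            linear_combination (w ^ (n + 1) * (z * f z)) * h1) x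
        have e2 : resolventIntegral R c s (fun z => z * (z * (z⁻¹ ^ (n + 2) * (z * f z)))) x =
            resolventIntegral R c s (fun z => z⁻¹ ^ n * (z * f z)) x :=
          resolventIntegral_congr R hs.le (fun z hz => by
            have h1 := mul_inv_cancel₀ (hsph z hz)
            generalize z⁻¹ = w at h1 ⊢
            linear_combination (w ^ n * (z * f z) * (z * w + 1)) * h1) x
        rwa [e1, e2, mul_comm] at h
  rw [e0, sub_zero, ← div_eq_inv_mul, le_div_iff₀ hc0] at h
  rwa [mul_comm]

theorem IsResolventOn.integral_sub_const_mul (hR : IsResolventOn T c r R) (hs : 0 < s)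
    (hsr : s < r) (hf : DifferentiableOn ℂ f (ball c r)) (x : H) :
    resolventIntegral R c s (fun z => (z - c) * f z) x =
      resolventIntegral R c s (fun z => z * f z) x - c • resolventIntegral R c s f x := by
  have hc := continuousOn_sphere hf hsr
  have h := hR.integral_add hs hsr (f := fun z => z * f z) (g := fun z => -c * f z)
    (continuousOn_id.mul hc) (continuousOn_const.mul hc) x
  rw [resolventIntegral_const_mul, neg_smul, ← sub_eq_add_neg] at h
  rw [← h]
  congr 1
  funext z
  ring

/-- On the spectral subspace of an isolated point `c` of the spectrum, a paranormal operator is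
`c I`. -/
theorem IsParanormal.integral_sub_eq_zero (hp : IsParanormal T) (hR : IsResolventOn T c r R)
    (hs : 0 < s) (hsr : s < r) (hrc : c = 0 ∨ r ≤ ‖c‖) (hf : DifferentiableOn ℂ f (ball c r))
    (x : H) : resolventIntegral R c s (fun z => (z - c) * f z) x = 0 := by
  have hq : DifferentiableOn ℂ (fun z => z - c) (ball c r) :=
    differentiableOn_id.sub (differentiableOn_const _)
  have h := le_of_forall_small (φ := fun t => t) (by fun_prop) hs fun t ht hts =>
    hR.norm_integral_mul_le hsr ht hts hf hq ht
      (fun z hz => (mem_sphere_iff_norm.1 hz).le) x fun n => by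
        set g : ℂ → ℂ := fun z => (z - c) ^ n * f z with hg
        have hgd : DifferentiableOn ℂ g (ball c r) := (hq.pow n).mul hf
        have hzg : DifferentiableOn ℂ (fun z => z * g z) (ball c r) := differentiableOn_id.mul hgd
        have hcg : DifferentiableOn ℂ (fun z => (z - c) * g z) (ball c r) := hq.mul hgd
        have e1 := hR.integral_sub_const_mul hs hsr hgd x
        have e2 := hR.integral_sub_const_mul hs hsr hcg x
        have e3 := hR.integral_sub_const_mul hs hsr hzg x
        have e4 : resolventIntegral R c s (fun z => z * ((z - c) * g z)) x =
            resolventIntegral R c s (fun z => (z - c) * (z * g z)) x := by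
          congr 1; funext z; ring
        have n1 := hp.norm_integral_mul_eq hR hs hsr hrc hgd x
        have n2 := hp.norm_integral_mul_eq hR hs hsr hrc hzg x
        have n3 := hp.norm_integral_mul_eq hR hs hsr hrc hcg x
        rw [e4, e3, e1] at n3
        have key := norm_sub_smul_sq_le n1 n2 n3
        rw [← e1, ← e3, ← e4, ← e2] at key
        simpa only [hg, ← mul_assoc, ← pow_succ'] using key
  rw [zero_mul] at h
  exact norm_le_zero_iff.1 h

end

section

variable {H : Type*} [NormedAddCommGroup H] [InnerProductSpace ℂ H] [CompleteSpace H]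

/-! ### The Riesz projection and Weyl's theorem -/

section

variable {T : H →ₗ.[ℂ] H} {c : ℂ} {r s : ℝ} {R : ℂ → H →L[ℂ] H}

/-- The operator `∮ (T - z I)⁻¹ dz`, which is `-2πi` times the Riesz projection of `c`. -/
theorem IsResolventOn.exists_clm_eq_integral (hR : IsResolventOn T c r R) (hs : 0 < s)
    (hsr : s < r) : ∃ E : H →L[ℂ] H, ∀ x, E x = resolventIntegral R c s (fun _ => 1) x := by
  have hi : CircleIntegrable R c s :=
    (hR.continuousOn.mono (sphere_subset_punctured hs hsr)).circleIntegrable hs.le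
  refine ⟨∮ z in C(c, s), R z, fun x => ?_⟩
  have h := (ContinuousLinearMap.apply ℂ H x).circleIntegral_comp_comm hi
  simpa [resolventIntegral] using h.symm

theorem IsResolventOn.integral_eigenvector (hR : IsResolventOn T c r R) (hs : 0 < s)
    (hsr : s < r) {u : H} (hu : (u, c • u) ∈ T.graph) :
    resolventIntegral R c s (fun _ => 1) u = -(2 * Real.pi * Complex.I) • u := by
  have h : Set.EqOn (fun z => (1 : ℂ) • R z u) (fun z => -(z - c)⁻¹ • u) (sphere c s) := by
    intro z hz
    have hzr := sphere_subset_punctured hs hsr hz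
    have h1 := (hR z hzr _ _).1 hu
    have hne : z - c ≠ 0 := sub_ne_zero.2 hzr.2
    rw [← sub_smul, map_smul, ← neg_sub z c] at h1
    simp only [one_smul]
    rw [← inv_neg, eq_inv_smul_iff₀ (neg_ne_zero.2 hne), h1]
  rw [resolventIntegral, circleIntegral.integral_congr hs.le h, circleIntegral.integral_smul_const]
  congr 1
  simpa [circleIntegral.integral_sub_center_inv c hs.ne'] using
    circleIntegral.integral_smul (-1 : ℂ) (fun z => (z - c)⁻¹) c s

theorem IsResolventOn.integral_sub_smul (hR : IsResolventOn T c r R) (hs : 0 < s)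
    (hsr : s < r) {u v : H} (huv : (u, v) ∈ T.graph) :
    resolventIntegral R c s (fun _ => 1) (v - c • u) =
      resolventIntegral R c s (fun z => (z - c) * 1) u := by
  have hcont : ContinuousOn (fun z : ℂ => (z - c) * 1) (sphere c s) := by fun_prop
  have h : Set.EqOn (fun z => (1 : ℂ) • R z (v - c • u)) (fun z => u + ((z - c) * 1) • R z u)
      (sphere c s) := by
    intro z hz
    have h1 := (hR z (sphere_subset_punctured hs hsr hz) _ _).1 huv
    have e : v - c • u = v - z • u + (z - c) • u := by module
    simp only [one_smul, mul_one]
    rw [e, map_add, h1, map_smul]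
  have h0 : (∮ _ in C(c, s), u) = 0 := by
    simpa using Complex.circleIntegral_eq_zero_of_differentiable_on_off_countable hs.le
      Set.countable_empty (f := fun _ : ℂ => u) (c := c) continuousOn_const
      (fun _ _ => differentiableAt_const _)
  rw [resolventIntegral, circleIntegral.integral_congr hs.le h, circleIntegral.integral_add
    (circleIntegrable_const u c s) (hR.circleIntegrable hs hsr hcont u), h0, zero_add]
  rfl

/-- Up to the factor `2πi`, the vector `∮ (z - c)⁻¹ (T - z I)⁻¹ x dz` solves
`(T - c I) u = (1 - P) x`, where `P` is the Riesz projection of `c`. -/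
theorem IsResolventOn.exists_mem_graph (hR : IsResolventOn T c r R) (hs : 0 < s)
    (hsr : s < r) (x : H) : ∃ u, (u, (2 * Real.pi * Complex.I) • x +
      resolventIntegral R c s (fun _ => 1) x + c • u) ∈ T.graph := by
  have hne : ∀ z ∈ sphere c s, z - c ≠ 0 := fun z hz =>
    sub_ne_zero.2 (sphere_subset_punctured hs hsr hz).2
  have hf : ContinuousOn (fun z : ℂ => (z - c)⁻¹) (sphere c s) :=
    ContinuousOn.inv₀ (by fun_prop) hne
  have h := hR.integral_mem_graph hs hsr hf x
  have e : resolventIntegral R c s (fun z => z * (z - c)⁻¹) x =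
      resolventIntegral R c s (fun z => 1 + c * (z - c)⁻¹) x :=
    resolventIntegral_congr R hs.le (fun z hz => by
      have := hne z hz
      field_simp
      ring) x
  rw [e, hR.integral_add hs hsr (f := fun _ => 1) (g := fun z => c * (z - c)⁻¹)
      continuousOn_const (continuousOn_const.mul hf),
    resolventIntegral_const_mul, circleIntegral.integral_sub_center_inv c hs.ne',
    ← add_assoc] at h
  exact ⟨_, h⟩

/-- If `T` is `c I` on the spectral subspace of the isolated point `c`, then
`H = N(T - c I) ⊕ R(T - c I)` with closed range, so that `T - c I` is Fredholm of index zero when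
its null space is finite-dimensional. -/
theorem IsResolventOn.isFredholm_shift (hR : IsResolventOn T c r R) (hs : 0 < s) (hsr : s < r)
    (hd : Dense (T.domain : Set H)) (hT : T.IsClosed)
    (hN : FiniteDimensional ℂ (nullSpace (shift T c)))
    (h0 : ∀ x, resolventIntegral R c s (fun z => (z - c) * 1) x = 0) :
    IsFredholm (shift T c) ∧ index (shift T c) = 0 := by
  obtain ⟨E, hE⟩ := hR.exists_clm_eq_integral hs hsr
  have hk : (2 * Real.pi * Complex.I : ℂ) ≠ 0 := Complex.two_pi_I_ne_zero
  set k : ℂ := 2 * Real.pi * Complex.I with hkdef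
  have hEN : ∀ x, E x ∈ nullSpace (shift T c) := by
    intro x
    have hone : DifferentiableOn ℂ (fun _ : ℂ => (1 : ℂ)) (ball c r) := differentiableOn_const _
    have h := hR.integral_mem_graph_of_differentiableOn hs hsr hone x
    have h' := hR.integral_sub_const_mul hs hsr hone x
    rw [h0, eq_comm, sub_eq_zero] at h'
    rwa [mem_nullSpace_shift, hE, ← h']
  have hEu : ∀ u ∈ nullSpace (shift T c), E u = -k • u := fun u hu => by
    rw [hE, hR.integral_eigenvector hs hsr (mem_nullSpace_shift.1 hu)]
  have hrange : rangeSpace (shift T c) = LinearMap.ker (E : H →ₗ[ℂ] H) := by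
    ext y
    rw [mem_rangeSpace_shift, LinearMap.mem_ker]
    constructor
    · rintro ⟨u, hu⟩
      have h := hR.integral_sub_smul hs hsr hu
      rw [h0, add_sub_cancel_right, ← hE] at h
      exact h
    · intro hy
      obtain ⟨u, hu⟩ := hR.exists_mem_graph hs hsr y
      rw [← hE, show E y = 0 from hy, add_zero, ← hkdef] at hu
      refine ⟨k⁻¹ • u, ?_⟩
      have h := T.graph.smul_mem k⁻¹ hu
      rwa [Prod.smul_mk, smul_add, inv_smul_smul₀ hk, smul_comm k⁻¹ c u] at h
  have hcompl : IsCompl (rangeSpace (shift T c)) (nullSpace (shift T c)) := by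
    rw [hrange]
    refine IsCompl.of_le ?_ ?_
    · rintro u ⟨h1, h2⟩
      have h := hEu u h2
      rw [show E u = 0 from h1, eq_comm, smul_eq_zero] at h
      exact h.resolve_left (neg_ne_zero.2 hk)
    · intro x _
      rw [Submodule.mem_sup]
      refine ⟨x + k⁻¹ • E x, ?_, -k⁻¹ • E x, Submodule.smul_mem _ _ (hEN x), by module⟩
      change E (x + k⁻¹ • E x) = 0
      rw [map_add, map_smul, hEu _ (hEN x), neg_smul, smul_neg, inv_smul_smul₀ hk]
      exact add_neg_cancel _
  have hclosed : IsClosed (rangeSpace (shift T c) : Set H) := by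
    rw [hrange]
    exact E.isClosed_ker
  have := hclosed.completeSpace_coe
  let e : nullSpace (shift T c) ≃ₗ[ℂ] (rangeSpace (shift T c))ᗮ :=
    (Submodule.quotientEquivOfIsCompl _ _ hcompl).symm.trans
      (Submodule.quotientEquivOfIsCompl _ _ (rangeSpace (shift T c)).isCompl_orthogonal)
  refine ⟨⟨hd, isClosed_shift hT c, hclosed, hN, e.finiteDimensional⟩, ?_⟩
  rw [index, e.finrank_eq, sub_self]

end

theorem IsParanormal.piZeroZero_subset {T : H →ₗ.[ℂ] H} (hd : Dense (T.domain : Set H))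
    (hT : T.IsClosed) (hp : IsParanormal T) : piZeroZero T ⊆ spec T \ weylSpec T := by
  rintro c ⟨-, ⟨r, hr, hiso⟩, hN⟩
  have hc : c ∈ closedBall c r ∩ spec T := hiso ▸ Set.mem_singleton c
  -- a smaller disc that leaves out `0`, unless `0` is its centre
  obtain ⟨r', hr', hrr', hrc⟩ : ∃ r', 0 < r' ∧ r' ≤ r ∧ (c = 0 ∨ r' ≤ ‖c‖) := by
    rcases eq_or_ne c 0 with h | h
    · exact ⟨r, hr, le_rfl, Or.inl h⟩
    · exact ⟨min r ‖c‖, lt_min hr (norm_pos_iff.2 h), min_le_left _ _, Or.inr (min_le_right _ _)⟩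
  have hex : ∀ z, ∃ S : H →L[ℂ] H, z ∈ ball c r' \ {c} → IsResolventAt T z S := by
    intro z
    by_cases hz : z ∈ ball c r' \ {c}
    · have hzs : z ∈ resolvent T := by
        by_contra h
        have : z ∈ closedBall c r ∩ spec T :=
          ⟨ball_subset_closedBall (ball_subset_ball hrr' hz.1), h⟩
        rw [hiso] at this
        exact hz.2 this
      obtain ⟨S, hS⟩ := mem_resolvent.1 hzs
      exact ⟨S, fun _ => hS⟩
    · exact ⟨0, fun h => absurd h hz⟩
  choose R hR using hex
  have hRon : IsResolventOn T c r' R := hR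
  have hs : 0 < r' / 2 := half_pos hr'
  have hsr : r' / 2 < r' := half_lt_self hr'
  exact ⟨hc.2, not_not.2 (hRon.isFredholm_shift hs hsr hd hT hN fun x =>
    hp.integral_sub_eq_zero hRon hs hsr hrc (differentiableOn_const _) x)⟩

end

end UnboundedOp

theorem theorem4 {H : Type*} [NormedAddCommGroup H] [InnerProductSpace ℂ H] [CompleteSpace H] :
    (∀ T : H →ₗ.[ℂ] H, Dense (T.domain : Set H) → T.IsClosed → UnboundedOp.IsParanormal T →
      UnboundedOp.SatisfiesWeyl T) ∧
    (∀ T : H →ₗ.[ℂ] H, T.IsClosed → UnboundedOp.IsSymm T → UnboundedOp.SatisfiesWeyl T) := by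
  have h : ∀ T : H →ₗ.[ℂ] H, Dense (T.domain : Set H) → T.IsClosed →
      UnboundedOp.IsParanormal T → UnboundedOp.SatisfiesWeyl T := fun T hd hT hp =>
    Set.Subset.antisymm (hp.spec_diff_weylSpec_subset hT) (hp.piZeroZero_subset hd hT)
  exact ⟨h, fun T hT hs => h T hs.1 hT hs.isParanormal⟩
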